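/- Let $n\ge 0$, $T\ge 1$, and let $A_0,\dots,A_{T-1}\in\mathbb{R}_{\ge0}^{n\times n}$ be row-stochastic. Let $\pi\subseteq\{1,\dots,n\}$ with $|\pi|=k$, let $C\in\{0,1\}^{k\times n}$ be the matrix whose rows are the standard basis vectors $e_i^\top$, $i\in\pi$, and $\overline C\in\{0,1\}^{(n-k)\times n}$ the matrix whose rows are $e_j^\top$, $j\notin\pi$. Let $\rho_0,\dots,\rho_T\in\mathbb{R}^k$. Assume the following regularity condition: there are nonnegative $n\times n$ matrices $M_0,\dots,M_{T-1}$ with $\operatorname{supp}M_t\subseteq\operatorname{supp}(\operatorname{diag}(M_t\mathbf 1)A_t)$ for all $t$, with $CM_t\mathbf 1=\rho_t$ for $0\le t\le T-1$, $CM_{T-1}^\top\mathbf 1=\rho_T$ and $M_t\mathbf 1=M_{t-1}^\top\mathbf 1$ for $1\le t\le T-1$, such that $(M_t)_{ij}>0$ whenever $(A_t)_{ij}>0$. Assume also that $\rho_T>0$ entrywise. Let $\hat\eta\in\mathbb{R}^{n-k}_{>0}$ and $\hat\mu:=C^\top\rho_0+\overline C^\top\hat\eta$. For $\lambda=(\lambda_0,\dots,\lambda_T)\in(\mathbb{R}^k)^{T+1}$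 put $u_t:=\exp(C^\top\lambda_t)$ (entrywise) and consider the dual of the entropic proximal subproblem, $$\max_{\lambda}\ J(\lambda):=\sum_{t=0}^T\lambda_t^\top\rho_t-\hat\mu^\top\operatorname{diag}(u_0)A_0\operatorname{diag}(u_1)A_1\cdots\operatorname{diag}(u_{T-1})A_{T-1}u_T .$$ For positive vectors $u_0,\dots,u_T\in\mathbb{R}^n$ define $\hat\phi_0:=\hat\mu$, $\phi_T:=\mathbf 1$ and $$\hat\phi_{t+1}=A_t^\top(\hat\phi_t\odot u_t)\quad(t=0,\dots,T-1),\qquad \phi_t=A_t(u_{t+1}\odot\phi_{t+1})\quad(t=T-1,\dots,0).$$ 1. (Block update.) For every $\lambda$ and every $t\in\{0,\dots,T\}$, with $\phi_t,\hat\phi_t$ computed from $u_s=\exp(C^\top\lambda_s)$, the vector $C(\phi_t\odot\hat\phi_t)$ is entrywise positive; the maximization of $J$ over the block $\lambda_t$, with all other blocks fixed, has a unique solution; and $\ell\in\mathbb{R}^k$ is this solution if and only if $v:=\exp(C^\top\ell)$ satisfies $$Cv=\rho_t\oslash C(\phi_t\odot\hat\phi_t),\qquad \overline C v=\mathbf 1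 .$$ 2. (Block coordinate ascent.) Let $\lambda^{(0)},\lambda^{(1)},\dots$ be the iterates of cyclic block coordinate ascent for $J$ from an arbitrary $\lambda^{(0)}$: in each sweep the blocks $t=0,\dots,T$ are replaced, in this order, by the maximizer of $J$ in that block. Then $u^{(s)}=\exp(C^\top\lambda^{(s)})$ are the iterates, started at $\exp(C^\top\lambda^{(0)})$, of the following Sinkhorn-type algorithm, and $\lambda^{(s)}$ converges to a maximizer of $J$. Algorithm, one sweep: compute $\phi_{T},\dots,\phi_0$ from the current $u$ by the backward recursion; then, with $\hat\phi_0=\hat\mu$, for $t=0,\dots,T$ set $u_t\leftarrow C^\top(\rho_t\oslash C(\phi_t\odot\hat\phi_t))+\overline C^\top\overline C\mathbf 1$ and, if $t<T$, $\hat\phi_{t+1}\leftarrow A_t^\top(\hat\phi_t\odot u_t)$. 3. (Arbitrary positive start.) Let the algorithm be started at arbitrary vectors $u_0,\dots,u_T\in\mathbb{R}^n_{>0}$. Then its iterates after the first, second, … sweep are $\exp(C^\top\lambda^{(0)}),\exp(C^\top\lambda^{(1)}),\dots$ for a sequence $(\lambda^{(s)})$ of block coordinate ascent iterates as in 2, and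 they converge to $\exp(C^\top\lambda^\star)$ for some maximizer $\lambda^\star$ of $J$. -/

import Mathlib

open Matrix Filter Topology

namespace PartialBridge

noncomputable section

variable {n T : ℕ}

/-- The selection matrix `C` of the observed states: its rows are the vectors `e_i`, `i ∈ π`
(the rows are indexed by the observed states themselves). -/
def obsMatrix (π : Finset (Fin n)) : Matrix {i // i ∈ π} (Fin n) ℝ :=
  Matrix.of fun a j => if j = a.1 then 1 else 0

/-- The complementary selection matrix `C̄`: its rows are the vectors `e_j`, `j ∉ π`. -/
def unobsMatrix (π : Finset (Fin n)) : Matrix {i // i ∉ π} (Fin n) ℝ :=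
  Matrix.of fun a j => if j = a.1 then 1 else 0

/-- `M_0, …, M_{T-1}` is a feasible point of the Schrödinger bridge problem with partial marginal
observations `ρ_0, …, ρ_T`. -/
structure IsFeasible (π : Finset (Fin n)) (A : Fin T → Matrix (Fin n) (Fin n) ℝ)
    (ρ : Fin (T + 1) → {i // i ∈ π} → ℝ) (M : Fin T → Matrix (Fin n) (Fin n) ℝ) : Prop where
  nonneg : ∀ t i j, 0 ≤ M t i j
  /-- The divergence of `M_t` from `diag(M_t 1) A_t` is defined only if `supp M_t` is contained in
  `supp (diag(M_t 1) A_t)`. -/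
  supp : ∀ t i j, (Matrix.diagonal (M t *ᵥ 1) * A t) i j = 0 → M t i j = 0
  /-- `C M_t 1 = ρ_t` for `t = 0, …, T-1`. -/
  obs : ∀ t : Fin T, obsMatrix π *ᵥ (M t *ᵥ 1) = ρ t.castSucc
  /-- `C M_{T-1}ᵀ 1 = ρ_T`. -/
  obs_last : ∀ t : Fin T, t.val + 1 = T → obsMatrix π *ᵥ ((M t)ᵀ *ᵥ 1) = ρ (Fin.last T)
  /-- `M_t 1 = M_{t-1}ᵀ 1` for `t = 1, …, T-1`. -/
  matching : ∀ s t : Fin T, t.val = s.val + 1 → M t *ᵥ 1 = (M s)ᵀ *ᵥ 1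

/-- The regularity assumption: some feasible point charges every transition that the prior allows. -/
def IsRegular (π : Finset (Fin n)) (A : Fin T → Matrix (Fin n) (Fin n) ℝ)
    (ρ : Fin (T + 1) → {i // i ∈ π} → ℝ) : Prop :=
  ∃ M, IsFeasible π A ρ M ∧ ∀ t i j, 0 < A t i j → 0 < M t i j

/-- The initial prior `μ̂ = Cᵀ ρ_0 + C̄ᵀ η̂` of the proximal subproblem. -/
def initialPrior (π : Finset (Fin n)) (ρ : Fin (T + 1) → {i // i ∈ π} → ℝ)
    (η : {i // i ∉ π} → ℝ) : Fin n → ℝ :=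
  (obsMatrix π)ᵀ *ᵥ ρ 0 + (unobsMatrix π)ᵀ *ᵥ η

/-- `exp (Cᵀ ℓ)`, entrywise. -/
def blockScaling (π : Finset (Fin n)) (l : {i // i ∈ π} → ℝ) : Fin n → ℝ :=
  fun i => Real.exp (((obsMatrix π)ᵀ *ᵥ l) i)

/-- `u_t = exp (Cᵀ λ_t)`, `t = 0, …, T`. -/
def scaling (π : Finset (Fin n)) (lam : Fin (T + 1) → {i // i ∈ π} → ℝ) :
    Fin (T + 1) → Fin n → ℝ :=
  fun t => blockScaling π (lam t)

/-- The vector `diag(u_0) A_0 diag(u_1) A_1 ⋯ diag(u_{T-1}) A_{T-1} u_T`. -/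
def chain (A : Fin T → Matrix (Fin n) (Fin n) ℝ) (u : Fin (T + 1) → Fin n → ℝ) : Fin n → ℝ :=
  Fin.reverseInduction (motive := fun _ => Fin n → ℝ) (u (Fin.last T))
    (fun t v => Matrix.diagonal (u t.castSucc) *ᵥ (A t *ᵥ v)) 0

/-- The objective of the unconstrained dual of the proximal subproblem,
`∑ λ_tᵀ ρ_t - μ̂ᵀ diag(u_0) A_0 diag(u_1) A_1 ⋯ A_{T-1} u_T` with `u_t = exp (Cᵀ λ_t)`. -/
def dualObjective (π : Finset (Fin n)) (A : Fin T → Matrix (Fin n) (Fin n) ℝ)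
    (ρ : Fin (T + 1) → {i // i ∈ π} → ℝ) (μ : Fin n → ℝ)
    (lam : Fin (T + 1) → {i // i ∈ π} → ℝ) : ℝ :=
  ∑ t, lam t ⬝ᵥ ρ t - μ ⬝ᵥ chain A (scaling π lam)

/-- Forward recursion: `φ̂_0 = μ̂`, `φ̂_{t+1} = A_tᵀ (φ̂_t ⊙ u_t)`. -/
def phiHat (A : Fin T → Matrix (Fin n) (Fin n) ℝ) (μ : Fin n → ℝ)
    (u : Fin (T + 1) → Fin n → ℝ) (t : Fin (T + 1)) : Fin n → ℝ :=
  Fin.induction (motive := fun _ => Fin n → ℝ) μ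
    (fun t x => (A t)ᵀ *ᵥ (x * u t.castSucc)) t

/-- Backward recursion: `φ_T = 1`, `φ_t = A_t (u_{t+1} ⊙ φ_{t+1})`. -/
def phi (A : Fin T → Matrix (Fin n) (Fin n) ℝ)
    (u : Fin (T + 1) → Fin n → ℝ) (t : Fin (T + 1)) : Fin n → ℝ :=
  Fin.reverseInduction (motive := fun _ => Fin n → ℝ) 1
    (fun t y => A t *ᵥ (u t.succ * y)) t

/-- `ℓ` maximizes `F` in the block `t` while the other blocks of `lam` are kept fixed. -/
def IsBlockMaximizer {k : Type*} (F : (Fin (T + 1) → k → ℝ) → ℝ)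
    (lam : Fin (T + 1) → k → ℝ) (t : Fin (T + 1)) (l : k → ℝ) : Prop :=
  ∀ l' : k → ℝ, F (Function.update lam t l') ≤ F (Function.update lam t l)

/-- The current point of a sweep that turns `old` into `new`, before block `t` is updated: the
blocks `r < t` have been updated already. -/
def midSweep {k : Type*} (old new : Fin (T + 1) → k → ℝ) (t : Fin (T + 1)) :
    Fin (T + 1) → k → ℝ :=
  fun r => if r < t then new r else old r

/-- `lam 0, lam 1, …` are the iterates (one for each full sweep) of cyclic block coordinate ascent
for `F`: in each sweep the blocks `t = 0, …, T` are maximized in this order. -/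
def IsBlockCoordinateAscent {k : Type*} (F : (Fin (T + 1) → k → ℝ) → ℝ)
    (lam : ℕ → Fin (T + 1) → k → ℝ) : Prop :=
  ∀ s t, IsBlockMaximizer F (midSweep (lam s) (lam (s + 1)) t) t (lam (s + 1) t)

/-- The update `u_t ← Cᵀ (ρ_t ⊘ C (φ_t ⊙ φ̂_t)) + C̄ᵀ C̄ 1`. -/
def blockUpdate (π : Finset (Fin n)) (ρt : {i // i ∈ π} → ℝ) (φ φh : Fin n → ℝ) : Fin n → ℝ :=
  (obsMatrix π)ᵀ *ᵥ (ρt / (obsMatrix π *ᵥ (φ * φh))) + (unobsMatrix π)ᵀ *ᵥ (unobsMatrix π *ᵥ 1)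

/-- The vectors `φ̂_t` computed in the forward pass of a sweep that starts from `u`: the `φ_t` come
from the preceding backward pass, and `φ̂_{t+1} = A_tᵀ (φ̂_t ⊙ u_t)` with the updated `u_t`. -/
def forwardPass (π : Finset (Fin n)) (A : Fin T → Matrix (Fin n) (Fin n) ℝ)
    (ρ : Fin (T + 1) → {i // i ∈ π} → ℝ) (μ : Fin n → ℝ)
    (u : Fin (T + 1) → Fin n → ℝ) (t : Fin (T + 1)) : Fin n → ℝ :=
  Fin.induction (motive := fun _ => Fin n → ℝ) μ
    (fun t x => (A t)ᵀ *ᵥ (x * blockUpdate π (ρ t.castSucc) (phi A u t.castSucc) x)) t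

/-- One sweep of the Sinkhorn-type algorithm: a backward pass for the `φ_t`, then a forward pass in
which `u_t` is updated for `t = 0, …, T`. -/
def sweep (π : Finset (Fin n)) (A : Fin T → Matrix (Fin n) (Fin n) ℝ)
    (ρ : Fin (T + 1) → {i // i ∈ π} → ℝ) (μ : Fin n → ℝ)
    (u : Fin (T + 1) → Fin n → ℝ) : Fin (T + 1) → Fin n → ℝ :=
  fun t => blockUpdate π (ρ t) (phi A u t) (forwardPass π A ρ μ u t)

end

end PartialBridge

/-! Expanding the matrix product over paths `x` turns the second term of `J` into a sum of `w_x
exp(a_x λ)`, where `a_x λ` adds up the observed multipliers met along `x`. The regular point `M`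
normalizes to a Markov chain `B` with the same support as `A` and with observed marginals `ρ_t`, so
the linear term of `J` is the mean of `a_x λ` under the path law `p` of `B`. Hence `-J = ∑ (w_x
exp(a_x λ) - p_x a_x λ)`, with `w_x` and `p_x` positive on the same paths
(`dualObjective_eq_sum_paths`, `pathWeight_pos_or_eq_zero`).

Such a sum bounds every exponent on its sublevel sets. There it is strongly convex with respect to
the exponents, although the `a_x` may have a common kernel, so that maximizers need not be unique. A
gradient-domination inequality still holds (`exists_expSum_gradient_dominated`). An exact block step
decreases `-J` by at least a multiple of the squared step, and after a sweep the gradient is at most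
a multiple of the step. The gap to the optimum therefore decays geometrically, the steps are
summable, and the iterates converge (`IsBlockCoordinateAscent.exists_tendsto`).

The identification with the algorithm rests on `dotProduct_chain`: the pairing can be read at any
time `t` as `u_t ⬝ (φ_t ⊙ φ̂_t)`, where `φ_t` involves only later blocks and `φ̂_t` only earlier
ones. The block problem then separates into scalar problems with explicit solutions, and within a
sweep `φ` comes from the old point and `φ̂` from the new one (`isBlockMaximizer_midSweep_iff`). -/

namespace PartialBridge

/-! ### Exponential sums: coercivity, strong convexity and gradient domination. -/

section ExpSum

variable {ι E : Type*} [Fintype ι] [NormedAddCommGroup E] [NormedSpace ℝ E]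

/-- The convex function `x ↦ ∑ j, (w_j exp (a_j x) - p_j a_j x)`. -/
noncomputable def expSum (w p : ι → ℝ) (a : ι → E →L[ℝ] ℝ) (x : E) : ℝ :=
  ∑ j, (w j * Real.exp (a j x) - p j * a j x)

/-- The derivative of `expSum w p a` at `x` in the direction `v`. -/
noncomputable def expSumDeriv (w p : ι → ℝ) (a : ι → E →L[ℝ] ℝ) (x v : E) : ℝ :=
  ∑ j, (w j * Real.exp (a j x) - p j) * a j v

/-- For `t ≥ -2`, square `1 + t/2 ≤ exp (t/2)`. For `t < -2` the left side is at most `1 + t/2`,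
which is negative. -/
theorem exp_quadratic_lower_bound {D t : ℝ} (hD : 2 ≤ D) (ht : -D ≤ t) :
    1 + t + 1 / (2 * D) * t ^ 2 ≤ Real.exp t := by
  have hD0 : 0 < D := by linarith
  have hc : 1 / (2 * D) ≤ 1 / 4 := by
    rw [div_le_div_iff₀ (by positivity) (by norm_num)]; linarith
  rcases le_or_gt (-2) t with h | h
  · have h1 : 1 + t / 2 ≤ Real.exp (t / 2) := by
      have := Real.add_one_le_exp (t / 2); linarith
    have h2 : Real.exp t = Real.exp (t / 2) ^ 2 := by
      rw [← Real.exp_nat_mul]; congr 1; push_cast; ring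
    have h3 : (1 + t / 2) ^ 2 ≤ Real.exp (t / 2) ^ 2 :=
      pow_le_pow_left₀ (by linarith) h1 2
    nlinarith [mul_le_mul_of_nonneg_right hc (sq_nonneg t)]
  · have h1 : 1 / (2 * D) * t ^ 2 ≤ -t / 2 := by
      rw [div_mul_eq_mul_div, one_mul, div_le_div_iff₀ (by positivity) (by norm_num)]
      nlinarith
    have := Real.exp_pos t
    linarith

/-- For `s > 0`, compare `w exp s` with its tangent of slope `2p`, which touches at `c = log
(2p/w)`; half of that slope survives the subtraction of `p s`. -/
theorem exp_sub_linear_lower_bound {w p : ℝ} (hw : 0 < w) (hp : 0 < p) (s : ℝ) :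
    p * |s| - |2 * p * (1 - Real.log (2 * p / w))| ≤ w * Real.exp s - p * s := by
  rcases le_or_gt s 0 with h | h
  · rw [abs_of_nonpos h]
    have := mul_pos hw (Real.exp_pos s)
    have := abs_nonneg (2 * p * (1 - Real.log (2 * p / w)))
    linarith
  · rw [abs_of_pos h]
    set c := Real.log (2 * p / w)
    have hc : w * Real.exp c = 2 * p := by
      rw [Real.exp_log (by positivity)]; field_simp
    have h1 : w * Real.exp s = 2 * p * Real.exp (s - c) := by
      rw [← hc, mul_assoc, ← Real.exp_add]; congr 2; ring
    have h2 := Real.add_one_le_exp (s - c)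
    have h3 : 2 * p * (s - c + 1) ≤ 2 * p * Real.exp (s - c) :=
      mul_le_mul_of_nonneg_left h2 (by positivity)
    have h4 := neg_abs_le (2 * p * (1 - c))
    rw [h1]
    linarith

variable {w p : ι → ℝ} (a : ι → E →L[ℝ] ℝ)

/-- Coercivity holds only in the values `a j x`: `x` itself may be unbounded along the common kernel
of the `a j`. -/
theorem exists_abs_le_of_expSum_le (hw : ∀ j, 0 < w j) (hp : ∀ j, 0 < p j) (F : ℝ) :
    ∃ R, 1 ≤ R ∧ ∀ x, expSum w p a x ≤ F → ∀ j, |a j x| ≤ R := by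
  set K := ∑ j, |2 * p j * (1 - Real.log (2 * p j / w j))|
  refine ⟨1 + ∑ j, |F + K| / p j, ?_, fun x hx j => ?_⟩
  · have : 0 ≤ ∑ j, |F + K| / p j :=
      Finset.sum_nonneg fun j _ => div_nonneg (abs_nonneg _) (hp j).le
    linarith
  · have h1 : ∑ j, p j * |a j x| - K ≤ expSum w p a x := by
      rw [← Finset.sum_sub_distrib]
      exact Finset.sum_le_sum fun j _ => exp_sub_linear_lower_bound (hw j) (hp j) _
    have h2 : p j * |a j x| ≤ ∑ j, p j * |a j x| :=
      Finset.single_le_sum (f := fun j => p j * |a j x|)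
        (fun j _ => mul_nonneg (hp j).le (abs_nonneg _)) (Finset.mem_univ j)
    have h3 : |F + K| / p j ≤ ∑ j, |F + K| / p j :=
      Finset.single_le_sum (f := fun j => |F + K| / p j)
        (fun j _ => div_nonneg (abs_nonneg _) (hp j).le) (Finset.mem_univ j)
    have h4 : |a j x| ≤ |F + K| / p j := by
      rw [le_div_iff₀ (hp j)]
      have := le_abs_self (F + K)
      linarith
    linarith

theorem exists_expSum_strong_convexity (hw : ∀ j, 0 < w j) {R : ℝ} (hR : 1 ≤ R) :
    ∃ m, 0 < m ∧ ∀ x y, (∀ j, |a j x| ≤ R) → (∀ j, |a j y| ≤ R) →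
      expSum w p a x + expSumDeriv w p a x (y - x) + m * ∑ j, (a j (y - x)) ^ 2 ≤
        expSum w p a y := by
  obtain ⟨w₀, hw₀, hw₀'⟩ : ∃ w₀, 0 < w₀ ∧ ∀ j, w₀ ≤ w j := by
    rcases isEmpty_or_nonempty ι with h | h
    · exact ⟨1, one_pos, fun j => h.elim j⟩
    · obtain ⟨j, hj⟩ := Finite.exists_min w
      exact ⟨w j, hw j, hj⟩
  refine ⟨w₀ * Real.exp (-R) * (1 / (2 * (2 * R))), by positivity, fun x y hx hy => ?_⟩
  unfold expSum expSumDeriv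
  rw [Finset.mul_sum, ← Finset.sum_add_distrib, ← Finset.sum_add_distrib]
  refine Finset.sum_le_sum fun j _ => ?_
  rw [map_sub]
  have hxj := abs_le.1 (hx j)
  have hyj := abs_le.1 (hy j)
  -- Two exponents bounded by `R` differ by at most `2R`, and `R ≥ 1` makes `D = 2R` admissible.
  have h1 := exp_quadratic_lower_bound (D := 2 * R) (t := a j y - a j x)
    (by linarith) (by linarith)
  have h2 : Real.exp (a j y) = Real.exp (a j x) * Real.exp (a j y - a j x) := by
    rw [← Real.exp_add]; congr 1; ring
  have h3 : w₀ * Real.exp (-R) ≤ w j * Real.exp (a j x) :=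
    mul_le_mul (hw₀' j) (Real.exp_le_exp.2 hxj.1) (Real.exp_pos _).le (hw j).le
  have h4 : 0 ≤ 1 / (2 * (2 * R)) * (a j y - a j x) ^ 2 := by positivity
  have h5 := mul_le_mul_of_nonneg_left h1
    (mul_pos (hw j) (Real.exp_pos (a j x))).le
  have h6 := mul_le_mul_of_nonneg_right h3 h4
  rw [h2]
  nlinarith

theorem exists_expSumDeriv_lipschitz (hw : ∀ j, 0 < w j) (R : ℝ) :
    ∃ L, 0 ≤ L ∧ ∀ x y v, (∀ j, |a j x| ≤ R) → (∀ j, |a j y| ≤ R) →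
      |expSumDeriv w p a x v - expSumDeriv w p a y v| ≤ L * ‖x - y‖ * ‖v‖ := by
  -- The tangent at the larger of the two exponents suffices, so only `t ≤ R` is needed; both orders
  -- are used below.
  have key : ∀ s t : ℝ, t ≤ R → Real.exp t - Real.exp s ≤ Real.exp R * |s - t| := by
    intro s t ht
    have h1 := Real.add_one_le_exp (s - t)
    have h2 : Real.exp s = Real.exp t * Real.exp (s - t) := by
      rw [← Real.exp_add]; congr 1; ring
    have h3 := mul_le_mul_of_nonneg_left h1 (Real.exp_pos t).le
    have h4 := mul_le_mul_of_nonneg_right (Real.exp_le_exp.2 ht) (abs_nonneg (s - t))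
    have h5 := mul_le_mul_of_nonneg_left (neg_abs_le (s - t)) (Real.exp_pos t).le
    linarith
  refine ⟨∑ j, w j * Real.exp R * ‖a j‖ * ‖a j‖,
    Finset.sum_nonneg fun j _ => by have := (hw j).le; positivity, fun x y v hx hy => ?_⟩
  unfold expSumDeriv
  rw [← Finset.sum_sub_distrib, Finset.sum_mul, Finset.sum_mul]
  refine (Finset.abs_sum_le_sum_abs _ _).trans (Finset.sum_le_sum fun j _ => ?_)
  have hwj := (hw j).le
  have h1 : |Real.exp (a j x) - Real.exp (a j y)| ≤ Real.exp R * (‖a j‖ * ‖x - y‖) := by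
    have h0 : |a j x - a j y| ≤ ‖a j‖ * ‖x - y‖ := by
      rw [← map_sub]; exact (a j).le_opNorm _
    have h2 := key (a j y) (a j x) (abs_le.1 (hx j)).2
    have h3 := key (a j x) (a j y) (abs_le.1 (hy j)).2
    rw [abs_sub_comm] at h2
    have h4 := mul_le_mul_of_nonneg_left h0 (Real.exp_pos R).le
    exact abs_le.2 ⟨by linarith, by linarith⟩
  have h2 : |a j v| ≤ ‖a j‖ * ‖v‖ := (a j).le_opNorm v
  calc |(w j * Real.exp (a j x) - p j) * a j v - (w j * Real.exp (a j y) - p j) * a j v|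
      = w j * |Real.exp (a j x) - Real.exp (a j y)| * |a j v| := by
        rw [← abs_of_nonneg hwj, ← abs_mul, ← abs_mul, abs_of_nonneg hwj]
        congr 1; ring
    _ ≤ w j * (Real.exp R * (‖a j‖ * ‖x - y‖)) * (‖a j‖ * ‖v‖) := by gcongr
    _ = _ := by ring

theorem norm_sq_le_sum_sq {κ : Type*} [Fintype κ] (v : κ → ℝ) : ‖v‖ ^ 2 ≤ ∑ i, v i ^ 2 := by
  have h0 : 0 ≤ ∑ i, v i ^ 2 := Finset.sum_nonneg fun i _ => sq_nonneg _
  have : ‖v‖ ≤ √(∑ i, v i ^ 2) := by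
    refine (pi_norm_le_iff_of_nonneg (Real.sqrt_nonneg _)).2 fun i => Real.abs_le_sqrt ?_
    exact Finset.single_le_sum (f := fun i => v i ^ 2) (fun i _ => sq_nonneg _)
      (Finset.mem_univ i)
  calc ‖v‖ ^ 2 ≤ √(∑ i, v i ^ 2) ^ 2 := pow_le_pow_left₀ (norm_nonneg _) this 2
    _ = _ := Real.sq_sqrt h0

/-- A linear right inverse of the evaluation map on its range discards the kernel component of `v`.
Derivatives of `expSum` see a direction only through its evaluations, so `v'` can replace `v` in
them. -/
theorem exists_norm_le_of_eval_eq :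
    ∃ B, 0 ≤ B ∧ ∀ v : E, ∃ v', (∀ j, a j v' = a j v) ∧
      ‖v'‖ ^ 2 ≤ B * ∑ j, (a j v) ^ 2 := by
  let S : E →ₗ[ℝ] (ι → ℝ) := LinearMap.pi fun j => (a j : E →ₗ[ℝ] ℝ)
  obtain ⟨g, hg⟩ := S.rangeRestrict.exists_rightInverse_of_surjective S.range_rangeRestrict
  let G := LinearMap.toContinuousLinearMap g
  refine ⟨‖G‖ ^ 2, by positivity, fun v => ⟨G (S.rangeRestrict v), fun j => ?_, ?_⟩⟩
  · have h := LinearMap.congr_fun hg (S.rangeRestrict v)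
    exact congr_fun (congr_arg Subtype.val h) j
  · have h1 : ‖G (S.rangeRestrict v)‖ ≤ ‖G‖ * ‖S v‖ := G.le_opNorm _
    calc ‖G (S.rangeRestrict v)‖ ^ 2 ≤ (‖G‖ * ‖S v‖) ^ 2 :=
          pow_le_pow_left₀ (norm_nonneg _) h1 2
      _ = ‖G‖ ^ 2 * ‖S v‖ ^ 2 := by ring
      _ ≤ _ := mul_le_mul_of_nonneg_left (norm_sq_le_sum_sq _) (by positivity)

/-- A Polyak–Łojasiewicz inequality on the region where the exponents are bounded. -/
theorem exists_expSum_gradient_dominated (hw : ∀ j, 0 < w j) {R : ℝ} (hR : 1 ≤ R) :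
    ∃ K, 0 ≤ K ∧ ∀ x y, (∀ j, |a j x| ≤ R) → (∀ j, |a j y| ≤ R) → ∀ G, 0 ≤ G →
      (∀ v, |expSumDeriv w p a x v| ≤ G * ‖v‖) →
        expSum w p a x - expSum w p a y ≤ K * G ^ 2 := by
  obtain ⟨m, hm, hconv⟩ := exists_expSum_strong_convexity (p := p) a hw hR
  obtain ⟨B, hB, hinv⟩ := exists_norm_le_of_eval_eq a
  refine ⟨B / (4 * m), by positivity, fun x y hx hy G hG hgrad => ?_⟩
  have h1 := hconv x y hx hy
  obtain ⟨v, hv, hvB⟩ := hinv (y - x)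
  have h2 : expSumDeriv w p a x (y - x) = expSumDeriv w p a x v := by
    simp only [expSumDeriv, hv]
  have h3 := (abs_le.1 (hgrad v)).1
  rw [← h2] at h3
  set Q := ∑ j, (a j (y - x)) ^ 2
  -- Young's inequality, with the constant chosen so that `m * Q` is absorbed by strong convexity;
  -- `B = 0` forces `v = 0`.
  have hkey : G * ‖v‖ ≤ B / (4 * m) * G ^ 2 + m * Q := by
    rcases hB.eq_or_lt with h0 | h0
    · rw [← h0, zero_mul] at hvB
      have : ‖v‖ = 0 := by nlinarith [norm_nonneg v]
      have hQ : 0 ≤ Q := Finset.sum_nonneg fun i _ => sq_nonneg _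
      rw [this, mul_zero]; positivity
    · have h4 : m / B * ‖v‖ ^ 2 ≤ m * Q := by
        rw [div_mul_eq_mul_div, div_le_iff₀ h0]
        nlinarith
      have h5 : B / (4 * m) * G ^ 2 + m / B * ‖v‖ ^ 2 - G * ‖v‖ =
          B / (4 * m) * (G - 2 * m / B * ‖v‖) ^ 2 := by
        field_simp; ring
      have h6 : 0 ≤ B / (4 * m) * (G - 2 * m / B * ‖v‖) ^ 2 := by positivity
      linarith
  linarith

theorem hasDerivAt_expSum_line (x v : E) :
    HasDerivAt (fun s : ℝ => expSum w p a (x + s • v)) (expSumDeriv w p a x v) 0 := by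
  unfold expSum expSumDeriv
  refine HasDerivAt.fun_sum fun j _ => ?_
  have h : HasDerivAt (fun s : ℝ => a j (x + s • v)) (a j v) 0 := by
    simp only [map_add, map_smul, smul_eq_mul]
    simpa using ((hasDerivAt_id (0 : ℝ)).mul_const (a j v)).const_add (a j x)
  refine ((h.exp.const_mul (w j)).sub (h.const_mul (p j))).congr_deriv ?_
  rw [zero_smul, add_zero]; ring

theorem expSumDeriv_eq_zero {x v : E}
    (h : ∀ s : ℝ, expSum w p a x ≤ expSum w p a (x + s • v)) : expSumDeriv w p a x v = 0 := by
  refine IsLocalMin.hasDerivAt_eq_zero (Eventually.of_forall fun s => ?_)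
    (hasDerivAt_expSum_line a x v)
  change expSum w p a (x + (0 : ℝ) • v) ≤ expSum w p a (x + s • v)
  simpa only [zero_smul, add_zero] using h s

theorem continuous_expSum : Continuous (expSum w p a) := by
  unfold expSum; fun_prop

end ExpSum

/-! ### Cyclic block descent: sufficient decrease and linear convergence. -/

section Descent

variable {κ : Type*} {T : ℕ}

theorem update_midSweep_last (old new : Fin (T + 1) → κ → ℝ) :
    Function.update (midSweep old new (Fin.last T)) (Fin.last T) (new (Fin.last T)) = new := by
  funext r
  rcases eq_or_ne r (Fin.last T) with rfl | h
  · simp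
  · simp [Function.update_of_ne h, midSweep, Fin.lt_last_iff_ne_last.2 h]

theorem update_midSweep_castSucc (old new : Fin (T + 1) → κ → ℝ) (t : Fin T) :
    Function.update (midSweep old new t.castSucc) t.castSucc (new t.castSucc) =
      midSweep old new t.succ := by
  funext r
  rcases eq_or_ne r t.castSucc with rfl | h
  · simp [midSweep]
  · have h' : r < t.succ ↔ r < t.castSucc := by
      rw [Fin.lt_def, Fin.lt_def]
      have := Fin.val_ne_of_ne h
      simp at this ⊢
      lia
    simp [Function.update_of_ne h, midSweep, h']

theorem midSweep_zero (old new : Fin (T + 1) → κ → ℝ) : midSweep old new 0 = old := by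
  funext r; simp [midSweep]

theorem update_midSweep_self (old new : Fin (T + 1) → κ → ℝ) (t : Fin (T + 1)) :
    Function.update (midSweep old new t) t (old t) = midSweep old new t := by
  conv_rhs => rw [← Function.update_eq_self t (midSweep old new t)]
  simp [midSweep]

theorem update_eq_add_smul_single (x : Fin (T + 1) → κ → ℝ) (t : Fin (T + 1))
    (l v : κ → ℝ) (s : ℝ) :
    Function.update x t (l + s • v) = Function.update x t l + s • (Pi.single t v : Fin (T + 1) → κ → ℝ) := by
  funext r
  rcases eq_or_ne r t with rfl | h
  · simp
  · simp [Function.update_of_ne h, Pi.single_eq_of_ne h]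

variable {f : (Fin (T + 1) → κ → ℝ) → ℝ} {old new : Fin (T + 1) → κ → ℝ}

theorem le_midSweep (h : ∀ t, f (midSweep old new t) ≤
    f (Function.update (midSweep old new t) t (new t))) (t : Fin (T + 1)) :
    f old ≤ f (midSweep old new t) := by
  induction t using Fin.induction with
  | zero => rw [midSweep_zero]
  | succ t ih =>
    rw [← update_midSweep_castSucc]
    exact ih.trans (h _)

theorem update_midSweep_le (h : ∀ t, f (midSweep old new t) ≤
    f (Function.update (midSweep old new t) t (new t))) (t : Fin (T + 1)) :
    f (Function.update (midSweep old new t) t (new t)) ≤ f new := by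
  induction t using Fin.reverseInduction with
  | last => rw [update_midSweep_last]
  | cast t ih =>
    rw [update_midSweep_castSucc]
    exact (h _).trans ih

variable [Fintype κ]

theorem norm_sub_update_midSweep_le (old new : Fin (T + 1) → κ → ℝ) (t : Fin (T + 1)) :
    ‖new - Function.update (midSweep old new t) t (new t)‖ ≤ ‖new - old‖ := by
  refine (pi_norm_le_iff_of_nonneg (norm_nonneg _)).2 fun r => ?_
  by_cases h : r < t
  · simp [Function.update_of_ne h.ne, midSweep, h]
  · rcases eq_or_ne r t with rfl | h'
    · simp
    · simpa [Function.update_of_ne h', midSweep, h] using norm_le_pi_norm (new - old) r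

/-- The rate hypothesis gives `e (s + 1) ≤ q * e s` with `q = K / (1 + K) < 1`, so step lengths are
bounded by a geometric sequence of ratio `√q`. -/
theorem tendsto_of_linear_rate {E : Type*} [NormedAddCommGroup E] [CompleteSpace E]
    {x : ℕ → E} {e : ℕ → ℝ} {m K : ℝ} (hm : 0 < m) (hK : 0 ≤ K) (he : ∀ s, 0 ≤ e s)
    (hstep : ∀ s, m * ‖x (s + 1) - x s‖ ^ 2 ≤ e s - e (s + 1))
    (hrate : ∀ s, e (s + 1) ≤ K * (e s - e (s + 1))) :
    ∃ y, Tendsto x atTop (𝓝 y) := by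
  set q := K / (1 + K) with hq
  have hq0 : 0 ≤ q := by positivity
  have hq1 : q < 1 := by rw [hq, div_lt_one (by positivity)]; linarith
  have h1 : ∀ s, e (s + 1) ≤ q * e s := fun s => by
    rw [hq, div_mul_eq_mul_div, le_div_iff₀ (by positivity)]
    linarith [hrate s]
  have h2 : ∀ s, e s ≤ q ^ s * e 0 := fun s => by
    induction s with
    | zero => simp
    | succ s ih =>
      calc e (s + 1) ≤ q * e s := h1 s
        _ ≤ q * (q ^ s * e 0) := mul_le_mul_of_nonneg_left ih hq0
        _ = _ := by ring
  refine cauchySeq_tendsto_of_complete (cauchySeq_of_le_geometric (√q) (√(e 0 / m)) ?_ ?_)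
  · rw [Real.sqrt_lt' one_pos]; simpa using hq1
  · intro s
    rw [dist_comm, dist_eq_norm]
    have h3 : ‖x (s + 1) - x s‖ ^ 2 ≤ e 0 / m * q ^ s := by
      rw [div_mul_eq_mul_div, le_div_iff₀ hm]
      linarith [hstep s, h2 s, he (s + 1)]
    calc ‖x (s + 1) - x s‖ ≤ √(e 0 / m * q ^ s) := by
          exact Real.le_sqrt_of_sq_le h3
      _ = √(e 0 / m) * √q ^ s := by
          rw [Real.sqrt_mul (div_nonneg (he 0) hm.le), Real.sqrt_eq_rpow (q ^ s),
            Real.sqrt_eq_rpow q, ← Real.rpow_natCast, ← Real.rpow_natCast,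
            ← Real.rpow_mul hq0, ← Real.rpow_mul hq0, mul_comm (s : ℝ)]

/-- Cyclic block coordinate ascent for the negative of an exponential sum converges to a
maximizer, provided that every coordinate is the restriction of some exponent to its block. -/
theorem IsBlockCoordinateAscent.exists_tendsto {ι : Type*} [Fintype ι] {w p : ι → ℝ}
    (hw : ∀ j, 0 < w j) (hp : ∀ j, 0 < p j)
    (a : ι → (Fin (T + 1) → κ → ℝ) →L[ℝ] ℝ)
    (ha : ∀ t i, ∃ j, ∀ l, a j (Pi.single t l) = l i)
    {F : (Fin (T + 1) → κ → ℝ) → ℝ} (hF : ∀ x, F x = -expSum w p a x)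
    {lam : ℕ → Fin (T + 1) → κ → ℝ} (hlam : IsBlockCoordinateAscent F lam) :
    ∃ lamStar, (∀ x, F x ≤ F lamStar) ∧ Tendsto lam atTop (𝓝 lamStar) := by
  set f := expSum w p a with hf
  set mid := fun s t => midSweep (lam s) (lam (s + 1)) t with hmid
  set nxt := fun s t => Function.update (mid s t) t (lam (s + 1) t) with hnxt
  have hblock : ∀ s t, F (mid s t) ≤ F (nxt s t) := fun s t => by
    have := hlam s t (lam s t)
    rwa [update_midSweep_self] at this
  have hmono : Antitone fun s => f (lam s) := by
    refine antitone_nat_of_succ_le fun s => ?_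
    have h1 := le_midSweep (hblock s) 0
    have h2 := (hblock s 0).trans (update_midSweep_le (hblock s) 0)
    have := h1.trans h2
    rw [hF, hF] at this
    linarith
  obtain ⟨R, hR, hbound⟩ := exists_abs_le_of_expSum_le a hw hp (f (lam 0))
  have hlam_bd : ∀ s j, |a j (lam s)| ≤ R := fun s => hbound _ (hmono (Nat.zero_le s))
  have hmid_le : ∀ s t, f (mid s t) ≤ f (lam s) := fun s t => by
    have := le_midSweep (hblock s) t
    rw [hF, hF] at this; linarith
  have hnxt_le : ∀ s t, f (nxt s t) ≤ f (mid s t) := fun s t => by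
    have := hblock s t
    rw [hF, hF] at this; linarith
  have hle_nxt : ∀ s t, f (lam (s + 1)) ≤ f (nxt s t) := fun s t => by
    have := update_midSweep_le (hblock s) t
    rw [hF, hF] at this; linarith
  have hmid_bd : ∀ s t j, |a j (mid s t)| ≤ R := fun s t =>
    hbound _ ((hmid_le s t).trans (hmono (Nat.zero_le s)))
  have hnxt_bd : ∀ s t j, |a j (nxt s t)| ≤ R := fun s t =>
    hbound _ ((hnxt_le s t).trans ((hmid_le s t).trans (hmono (Nat.zero_le s))))
  have hstat : ∀ s t v, expSumDeriv w p a (nxt s t) (Pi.single t v) = 0 := by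
    refine fun s t v => expSumDeriv_eq_zero a fun r => ?_
    have := hlam s t (lam (s + 1) t + r • v)
    rw [update_eq_add_smul_single, hF, hF] at this
    linarith
  obtain ⟨m, hm, hconv⟩ := exists_expSum_strong_convexity (p := p) a hw hR
  obtain ⟨L, hL, hlip⟩ := exists_expSumDeriv_lipschitz (p := p) a hw R
  obtain ⟨K, hK, hPL⟩ := exists_expSum_gradient_dominated (p := p) a hw hR
  have hstep_block : ∀ s t, m * ‖lam (s + 1) t - lam s t‖ ^ 2 ≤ f (lam s) - f (lam (s + 1)) := by
    intro s t
    -- Strong convexity is expanded at the block optimum, where the first-order term along the block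
    -- vanishes.
    have h1 := hconv (nxt s t) (mid s t) (hnxt_bd s t) (hmid_bd s t)
    have h2 : mid s t - nxt s t = Pi.single t (lam s t - lam (s + 1) t) := by
      funext r
      rcases eq_or_ne r t with rfl | h
      · simp [hnxt, hmid, midSweep]
      · simp [hnxt, Function.update_of_ne h, Pi.single_eq_of_ne h]
    rw [h2, hstat] at h1
    set δ := lam s t - lam (s + 1) t
    -- Each coordinate of `δ` is itself the value of some exponent, so no direction inside a single
    -- block is lost to the kernel.
    have h3 : ‖δ‖ ^ 2 ≤ ∑ j, (a j (Pi.single t δ)) ^ 2 := by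
      have h0 : 0 ≤ ∑ j, (a j (Pi.single t δ)) ^ 2 := Finset.sum_nonneg fun i _ => sq_nonneg _
      have : ‖δ‖ ≤ √(∑ j, (a j (Pi.single t δ)) ^ 2) := by
        refine (pi_norm_le_iff_of_nonneg (Real.sqrt_nonneg _)).2 fun i => Real.abs_le_sqrt ?_
        obtain ⟨j, hj⟩ := ha t i
        rw [← hj δ]
        exact Finset.single_le_sum (f := fun j => (a j (Pi.single t δ)) ^ 2)
          (fun i _ => sq_nonneg _) (Finset.mem_univ j)
      exact (Real.le_sqrt (norm_nonneg _) h0).1 this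
    rw [norm_sub_rev]
    have h4 := mul_le_mul_of_nonneg_left h3 hm.le
    have h5 := hmid_le s t
    have h6 := hle_nxt s t
    linarith
  have hstep : ∀ s, m * ‖lam (s + 1) - lam s‖ ^ 2 ≤ f (lam s) - f (lam (s + 1)) := by
    intro s
    obtain ⟨t, ht⟩ := Finite.exists_max fun t => ‖lam (s + 1) t - lam s t‖
    have : ‖lam (s + 1) - lam s‖ ≤ ‖lam (s + 1) t - lam s t‖ :=
      (pi_norm_le_iff_of_nonneg (norm_nonneg _)).2 ht
    exact (mul_le_mul_of_nonneg_left (pow_le_pow_left₀ (norm_nonneg _) this 2) hm.le).trans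
      (hstep_block s t)
  have hgrad : ∀ s v, |expSumDeriv w p a (lam (s + 1)) v| ≤
      (T + 1) * L * ‖lam (s + 1) - lam s‖ * ‖v‖ := by
    intro s v
    -- The derivative is split into blocks, and each block term is compared with the point of the
    -- sweep at which it was exactly zero.
    have h1 : expSumDeriv w p a (lam (s + 1)) v =
        ∑ t, (expSumDeriv w p a (lam (s + 1)) (Pi.single t (v t)) -
          expSumDeriv w p a (nxt s t) (Pi.single t (v t))) := by
      simp only [hstat, sub_zero]
      unfold expSumDeriv
      rw [Finset.sum_comm]
      refine Finset.sum_congr rfl fun j _ => ?_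
      rw [← Finset.mul_sum, ← map_sum, Finset.univ_sum_single]
    rw [h1]
    refine (Finset.abs_sum_le_sum_abs _ _).trans ?_
    calc _ ≤ ∑ _t : Fin (T + 1), L * ‖lam (s + 1) - lam s‖ * ‖v‖ := by
          refine Finset.sum_le_sum fun t _ =>
            (hlip _ _ _ (hlam_bd (s + 1)) (hnxt_bd s t)).trans ?_
          have h2 := norm_sub_update_midSweep_le (lam s) (lam (s + 1)) t
          have h3 : ‖(Pi.single t (v t) : Fin (T + 1) → κ → ℝ)‖ ≤ ‖v‖ := by
            rw [Pi.norm_single]; exact norm_le_pi_norm v t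
          gcongr
      _ = _ := by simp; ring
  set K' := K * ((T + 1) * L) ^ 2 / m with hK'
  have hK'0 : 0 ≤ K' := by positivity
  have hgap : ∀ s y, f (lam (s + 1)) - f y ≤ K' * (f (lam s) - f (lam (s + 1))) := by
    intro s y
    have hpos : 0 ≤ f (lam s) - f (lam (s + 1)) := le_trans (by positivity) (hstep s)
    -- Gradient domination needs bounded exponents at `y`; this is available precisely when `y` lies
    -- below the current value, and otherwise the gap is nonpositive.
    rcases le_total (f (lam (s + 1))) (f y) with h | h
    · have := mul_nonneg hK'0 hpos
      linarith
    · have hy := hbound y (h.trans (hmono (Nat.zero_le _)))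
      have h1 := hPL _ y (hlam_bd (s + 1)) hy _ (by positivity) (hgrad s)
      refine h1.trans ?_
      calc K * ((T + 1) * L * ‖lam (s + 1) - lam s‖) ^ 2
          = K' * (m * ‖lam (s + 1) - lam s‖ ^ 2) := by rw [hK']; field_simp
        _ ≤ _ := mul_le_mul_of_nonneg_left (hstep s) hK'0
  have hbdd : BddBelow (Set.range f) := by
    refine ⟨f (lam 1) - K' * (f (lam 0) - f (lam 1)), ?_⟩
    rintro _ ⟨y, rfl⟩
    linarith [hgap 0 y]
  have hinf : ∀ y, (⨅ y, f y) ≤ f y := fun y => ciInf_le hbdd y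
  have hrate : ∀ s, f (lam (s + 1)) - (⨅ y, f y) ≤
      K' * ((f (lam s) - ⨅ y, f y) - (f (lam (s + 1)) - ⨅ y, f y)) := by
    intro s
    have : f (lam (s + 1)) - K' * (f (lam s) - f (lam (s + 1))) ≤ ⨅ y, f y :=
      le_ciInf fun y => by linarith [hgap s y]
    rw [sub_sub_sub_cancel_right]; linarith
  obtain ⟨y, hy⟩ := tendsto_of_linear_rate hm hK'0
    (e := fun s => f (lam s) - ⨅ y, f y) (fun s => sub_nonneg.2 (hinf _))
    (fun s => by simpa using hstep s) hrate
  refine ⟨y, fun x => ?_, hy⟩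
  have hfy : Tendsto (fun s => f (lam s)) atTop (𝓝 (f y)) :=
    ((continuous_expSum a).tendsto y).comp hy
  have hfy' : Tendsto (fun s => f (lam (s + 1))) atTop (𝓝 (f y)) :=
    hfy.comp (tendsto_add_atTop_nat 1)
  -- In the limit the decrease tends to zero, so the gap bound says that the limit is optimal.
  have h1 : f y - f x ≤ K' * (f y - f y) :=
    le_of_tendsto_of_tendsto' (hfy'.sub_const (f x)) ((hfy.sub hfy').const_mul K')
      fun s => hgap s x
  rw [hF, hF]
  linarith

end Descent

end PartialBridge

namespace PartialBridge

/-! ### Forward and backward recursions, and the expansion over paths. -/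

section Recursions

variable {n T : ℕ} {A : Fin T → Matrix (Fin n) (Fin n) ℝ} {μ : Fin n → ℝ}
  {u u' : Fin (T + 1) → Fin n → ℝ}

theorem phi_last : phi A u (Fin.last T) = 1 := by
  simp [phi]

theorem phi_castSucc (t : Fin T) :
    phi A u t.castSucc = A t *ᵥ (u t.succ * phi A u t.succ) := by
  simp [phi]

theorem phiHat_zero : phiHat A μ u 0 = μ := rfl

theorem phiHat_succ (t : Fin T) :
    phiHat A μ u t.succ = (A t)ᵀ *ᵥ (phiHat A μ u t.castSucc * u t.castSucc) := by
  simp [phiHat]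

theorem phi_congr {t : Fin (T + 1)} (h : ∀ r, t < r → u r = u' r) :
    phi A u t = phi A u' t := by
  induction t using Fin.reverseInduction with
  | last => rw [phi_last, phi_last]
  | cast t ih =>
    rw [phi_castSucc, phi_castSucc, h _ Fin.castSucc_lt_succ,
      ih fun r hr => h r (Fin.castSucc_lt_succ.trans hr)]

theorem phiHat_congr {t : Fin (T + 1)} (h : ∀ r, r < t → u r = u' r) :
    phiHat A μ u t = phiHat A μ u' t := by
  induction t using Fin.induction with
  | zero => rfl
  | succ t ih =>
    rw [phiHat_succ, phiHat_succ, h _ Fin.castSucc_lt_succ,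
      ih fun r hr => h r (hr.trans Fin.castSucc_lt_succ)]

theorem chain_eq : chain A u = u 0 * phi A u 0 := by
  suffices h : ∀ t, Fin.reverseInduction (motive := fun _ => Fin n → ℝ) (u (Fin.last T))
      (fun t v => Matrix.diagonal (u t.castSucc) *ᵥ (A t *ᵥ v)) t = u t * phi A u t from h 0
  intro t
  induction t using Fin.reverseInduction with
  | last => rw [Fin.reverseInduction_last, phi_last, mul_one]
  | cast t ih =>
    rw [Fin.reverseInduction_castSucc, ih, phi_castSucc]
    funext i
    rw [mulVec_diagonal, Pi.mul_apply]

/-- The pairing of the two recursions does not depend on the time at which it is evaluated. -/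
theorem dotProduct_chain (t : Fin (T + 1)) :
    μ ⬝ᵥ chain A u = u t ⬝ᵥ (phi A u t * phiHat A μ u t) := by
  induction t using Fin.induction with
  | zero =>
    rw [chain_eq, phiHat_zero]
    simp only [dotProduct, Pi.mul_apply]
    exact Finset.sum_congr rfl fun i _ => by ring
  | succ t ih =>
    rw [ih, phi_castSucc, phiHat_succ]
    have h1 : u t.castSucc ⬝ᵥ (A t *ᵥ (u t.succ * phi A u t.succ) * phiHat A μ u t.castSucc) =
        (phiHat A μ u t.castSucc * u t.castSucc) ⬝ᵥ A t *ᵥ (u t.succ * phi A u t.succ) := by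
      simp only [dotProduct, Pi.mul_apply]
      exact Finset.sum_congr rfl fun i _ => by ring
    rw [h1, dotProduct_mulVec, ← mulVec_transpose]
    simp only [dotProduct, Pi.mul_apply]
    exact Finset.sum_congr rfl fun i _ => by ring

theorem phi_tail {A : Fin (T + 1) → Matrix (Fin n) (Fin n) ℝ} {u : Fin (T + 2) → Fin n → ℝ}
    (t : Fin (T + 1)) :
    phi A u t.succ = phi (fun s => A s.succ) (fun s => u s.succ) t := by
  induction t using Fin.reverseInduction with
  | last => rw [Fin.succ_last, phi_last, phi_last]
  | cast t ih => rw [Fin.succ_castSucc, phi_castSucc, phi_castSucc, ih]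

/-- The weight of a path under the initial weights `μ` and the transition matrices `A`. -/
noncomputable def pathWeight (A : Fin T → Matrix (Fin n) (Fin n) ℝ) (μ : Fin n → ℝ)
    (x : Fin (T + 1) → Fin n) : ℝ :=
  μ (x 0) * ∏ t : Fin T, A t (x t.castSucc) (x t.succ)

theorem chain_apply_eq_sum_paths (A : Fin T → Matrix (Fin n) (Fin n) ℝ)
    (u : Fin (T + 1) → Fin n → ℝ) (i : Fin n) :
    chain A u i = ∑ y : Fin T → Fin n,
      (∏ t : Fin T, A t ((Fin.cons i y : Fin (T + 1) → Fin n) t.castSucc) (y t)) *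
        ∏ t, u t ((Fin.cons i y : Fin (T + 1) → Fin n) t) := by
  induction T generalizing i with
  | zero =>
    rw [chain_eq, show (0 : Fin 1) = Fin.last 0 from rfl, phi_last]
    simp
  | succ T ih =>
    have h1 : phi A u 0 = A 0 *ᵥ chain (fun s => A s.succ) (fun s => u s.succ) := by
      rw [chain_eq, ← phi_tail, ← Fin.castSucc_zero, phi_castSucc]
    rw [chain_eq, h1, Pi.mul_apply, mulVec, dotProduct, Finset.mul_sum,
      ← (Fin.consEquiv fun _ => Fin n).sum_comp, Fintype.sum_prod_type]
    refine Finset.sum_congr rfl fun j _ => ?_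
    rw [ih, Finset.mul_sum, Finset.mul_sum]
    refine Finset.sum_congr rfl fun y _ => ?_
    rw [show (Fin.consEquiv fun _ => Fin n) (j, y) = (Fin.cons j y : Fin (T + 1) → Fin n) from rfl]
    simp only [Fin.prod_univ_succ, Fin.castSucc_zero, Fin.cons_zero, Fin.cons_succ,
      ← Fin.succ_castSucc]
    ring

theorem dotProduct_chain_eq_sum_paths :
    μ ⬝ᵥ chain A u = ∑ x, pathWeight A μ x * ∏ t, u t (x t) := by
  rw [← (Fin.consEquiv fun _ => Fin n).sum_comp, Fintype.sum_prod_type, dotProduct]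
  refine Finset.sum_congr rfl fun i _ => ?_
  rw [chain_apply_eq_sum_paths, Finset.mul_sum]
  refine Finset.sum_congr rfl fun y _ => ?_
  simp only [Fin.consEquiv_apply, pathWeight, Fin.cons_zero, Fin.cons_succ]
  ring

/-- The time marginals of the path measure of a Markov chain. -/
theorem sum_pathWeight_mul {B : Fin T → Matrix (Fin n) (Fin n) ℝ} {m : Fin (T + 1) → Fin n → ℝ}
    (hB : ∀ t, B t *ᵥ 1 = 1) (hm : ∀ t : Fin T, (B t)ᵀ *ᵥ m t.castSucc = m t.succ)
    (t : Fin (T + 1)) (g : Fin n → ℝ) :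
    ∑ x, pathWeight B (m 0) x * g (x t) = m t ⬝ᵥ g := by
  have h1 : ∀ s, phi B 1 s = 1 := by
    intro s
    induction s using Fin.reverseInduction with
    | last => exact phi_last
    | cast s ih => rw [phi_castSucc, ih, Pi.one_apply, one_mul, hB]
  have h2 : ∀ s, phiHat B (m 0) 1 s = m s := by
    intro s
    induction s using Fin.induction with
    | zero => rfl
    | succ s ih => rw [phiHat_succ, ih, Pi.one_apply, mul_one, hm]
  -- Take scaling `1` except for `g` at time `t`: the product along a path collapses to `g (x t)`,
  -- while both recursions keep their values for the scaling `1`.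
  have h3 := dotProduct_chain (A := B) (μ := m 0) (u := Function.update 1 t g) t
  rw [phi_congr (u' := 1) fun r hr => Function.update_of_ne hr.ne' _ _,
    phiHat_congr (u' := 1) fun r hr => Function.update_of_ne hr.ne _ _, h1, h2,
    Function.update_self, one_mul, dotProduct_chain_eq_sum_paths, dotProduct_comm g] at h3
  rw [← h3]
  refine Finset.sum_congr rfl fun x _ => ?_
  rw [Finset.prod_eq_single t (fun s _ hs => by simp [Function.update_of_ne hs]) (by simp),
    Function.update_self]

theorem mulVec_apply_pos {B : Matrix (Fin n) (Fin n) ℝ} {v : Fin n → ℝ} {i j : Fin n}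
    (hB : ∀ j, 0 ≤ B i j) (hv : ∀ j, 0 < v j) (hj : 0 < B i j) : 0 < (B *ᵥ v) i :=
  Finset.sum_pos' (fun j _ => mul_nonneg (hB j) (hv j).le)
    ⟨j, Finset.mem_univ j, mul_pos hj (hv j)⟩

theorem phi_pos (hA : ∀ t i j, 0 ≤ A t i j) (hrow : ∀ t i, ∃ j, 0 < A t i j)
    (hu : ∀ t i, 0 < u t i) (t : Fin (T + 1)) (i : Fin n) : 0 < phi A u t i := by
  induction t using Fin.reverseInduction generalizing i with
  | last => simp [phi_last]
  | cast t ih =>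
    rw [phi_castSucc]
    obtain ⟨j, hj⟩ := hrow t i
    exact mulVec_apply_pos (hA t i) (fun j => mul_pos (hu _ j) (ih j)) hj

/-- Positivity is claimed only where `m t` is positive: at the final time an unobserved state may be
unreachable. -/
theorem phiHat_pos (hA : ∀ t i j, 0 ≤ A t i j) {m : Fin (T + 1) → Fin n → ℝ}
    (hm : ∀ (t : Fin T) i, 0 < m t.castSucc i)
    (hcol : ∀ (t : Fin T) j, 0 < m t.succ j → ∃ i, 0 < A t i j) (hμ : ∀ i, 0 < μ i)
    {t : Fin (T + 1)} (hu : ∀ r, r < t → ∀ i, 0 < u r i) {i : Fin n} (hi : 0 < m t i) :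
    0 < phiHat A μ u t i := by
  induction t using Fin.induction generalizing i with
  | zero => exact hμ i
  | succ t ih =>
    rw [phiHat_succ]
    obtain ⟨j, hj⟩ := hcol t i hi
    refine mulVec_apply_pos (j := j) (fun j => hA t j i) (fun j => mul_pos ?_ ?_) hj
    · exact ih (fun r hr => hu r (hr.trans Fin.castSucc_lt_succ)) (hm t j)
    · exact hu _ Fin.castSucc_lt_succ j

end Recursions

/-! ### Coordinates of the selection matrices, scalings and updates. -/

section Matrices

variable {n T : ℕ} {π : Finset (Fin n)}

theorem obsMatrix_mulVec (v : Fin n → ℝ) (i : {i // i ∈ π}) : (obsMatrix π *ᵥ v) i = v i := by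
  simp [obsMatrix, mulVec, dotProduct]

theorem unobsMatrix_mulVec (v : Fin n → ℝ) (i : {i // i ∉ π}) :
    (unobsMatrix π *ᵥ v) i = v i := by
  simp [unobsMatrix, mulVec, dotProduct]

theorem obsMatrix_transpose_mulVec_mem (l : {i // i ∈ π} → ℝ) {i : Fin n} (hi : i ∈ π) :
    ((obsMatrix π)ᵀ *ᵥ l) i = l ⟨i, hi⟩ := by
  rw [mulVec, dotProduct, Finset.sum_eq_single ⟨i, hi⟩]
  · simp [obsMatrix]
  · intro b _ hb
    have : i ≠ b := fun h => hb (Subtype.ext h.symm)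
    simp [obsMatrix, this]
  · simp

theorem obsMatrix_transpose_mulVec_notMem (l : {i // i ∈ π} → ℝ) {i : Fin n} (hi : i ∉ π) :
    ((obsMatrix π)ᵀ *ᵥ l) i = 0 := by
  rw [mulVec, dotProduct, Finset.sum_eq_zero]
  intro b _
  have : i ≠ b := fun h => hi (h ▸ b.2)
  simp [obsMatrix, this]

theorem unobsMatrix_transpose_mulVec_notMem (l : {i // i ∉ π} → ℝ) {i : Fin n} (hi : i ∉ π) :
    ((unobsMatrix π)ᵀ *ᵥ l) i = l ⟨i, hi⟩ := by
  rw [mulVec, dotProduct, Finset.sum_eq_single ⟨i, hi⟩]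
  · simp [unobsMatrix]
  · intro b _ hb
    have : i ≠ b := fun h => hb (Subtype.ext h.symm)
    simp [unobsMatrix, this]
  · simp

theorem unobsMatrix_transpose_mulVec_mem (l : {i // i ∉ π} → ℝ) {i : Fin n} (hi : i ∈ π) :
    ((unobsMatrix π)ᵀ *ᵥ l) i = 0 := by
  rw [mulVec, dotProduct, Finset.sum_eq_zero]
  intro b _
  have : i ≠ b := fun h => b.2 (h ▸ hi)
  simp [unobsMatrix, this]

theorem blockScaling_mem (l : {i // i ∈ π} → ℝ) {i : Fin n} (hi : i ∈ π) :
    blockScaling π l i = Real.exp (l ⟨i, hi⟩) := by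
  rw [blockScaling, obsMatrix_transpose_mulVec_mem]

theorem blockScaling_notMem (l : {i // i ∈ π} → ℝ) {i : Fin n} (hi : i ∉ π) :
    blockScaling π l i = 1 := by
  rw [blockScaling, obsMatrix_transpose_mulVec_notMem _ hi, Real.exp_zero]

theorem blockUpdate_mem (r : {i // i ∈ π} → ℝ) (φ φh : Fin n → ℝ) {i : Fin n} (hi : i ∈ π) :
    blockUpdate π r φ φh i = r ⟨i, hi⟩ / (φ i * φh i) := by
  rw [blockUpdate, Pi.add_apply, obsMatrix_transpose_mulVec_mem _ hi,
    unobsMatrix_transpose_mulVec_mem _ hi, add_zero, Pi.div_apply, obsMatrix_mulVec, Pi.mul_apply]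

theorem blockUpdate_notMem (r : {i // i ∈ π} → ℝ) (φ φh : Fin n → ℝ) {i : Fin n}
    (hi : i ∉ π) : blockUpdate π r φ φh i = 1 := by
  rw [blockUpdate, Pi.add_apply, obsMatrix_transpose_mulVec_notMem _ hi,
    unobsMatrix_transpose_mulVec_notMem _ hi, zero_add, unobsMatrix_mulVec, Pi.one_apply]

theorem blockScaling_eq_blockUpdate_iff {l r : {i // i ∈ π} → ℝ} {φ φh : Fin n → ℝ} :
    blockScaling π l = blockUpdate π r φ φh ↔ ∀ i, Real.exp (l i) = r i / (φ i * φh i) := by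
  refine ⟨fun h i => ?_, fun h => funext fun i => ?_⟩
  · have := congr_fun h i
    rwa [blockScaling_mem _ i.2, blockUpdate_mem _ _ _ i.2] at this
  · by_cases hi : i ∈ π
    · rw [blockScaling_mem _ hi, blockUpdate_mem _ _ _ hi, h]
    · rw [blockScaling_notMem _ hi, blockUpdate_notMem _ _ _ hi]

theorem blockScaling_pos (l : {i // i ∈ π} → ℝ) (i : Fin n) : 0 < blockScaling π l i :=
  Real.exp_pos _

theorem continuous_scaling : Continuous (scaling (T := T) π) := by
  refine continuous_pi fun t => continuous_pi fun i => Real.continuous_exp.comp ?_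
  exact (continuous_apply i).comp
    (Continuous.matrix_mulVec continuous_const (continuous_apply t))

theorem initialPrior_pos {ρ : Fin (T + 1) → {i // i ∈ π} → ℝ} {η : {i // i ∉ π} → ℝ}
    (hρ : ∀ i, 0 < ρ 0 i) (hη : ∀ j, 0 < η j) (i : Fin n) : 0 < initialPrior π ρ η i := by
  rw [initialPrior, Pi.add_apply]
  by_cases hi : i ∈ π
  · rw [obsMatrix_transpose_mulVec_mem _ hi, unobsMatrix_transpose_mulVec_mem _ hi, add_zero]
    exact hρ _
  · rw [obsMatrix_transpose_mulVec_notMem _ hi, unobsMatrix_transpose_mulVec_notMem _ hi,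
      zero_add]
    exact hη _

end Matrices

end PartialBridge

namespace PartialBridge

/-! ### From a regular feasible point to a Markov chain. -/

section Regularity

variable {n T : ℕ} {π : Finset (Fin n)} {A : Fin T → Matrix (Fin n) (Fin n) ℝ}
  {ρ : Fin (T + 1) → {i // i ∈ π} → ℝ}

theorem exists_pos_of_mem_rowStochastic {B : Matrix (Fin n) (Fin n) ℝ}
    (hB : B ∈ Matrix.rowStochastic ℝ (Fin n)) (i : Fin n) : ∃ j, 0 < B i j := by
  by_contra! h
  have h1 : (B *ᵥ 1) i = 1 := by rw [hB.2]; rfl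
  have h2 : (B *ᵥ 1) i ≤ 0 := by
    rw [mulVec, dotProduct]
    exact Finset.sum_nonpos fun j _ => by simpa using h j
  linarith

/-- The marginals of a feasible point. -/
theorem IsFeasible.exists_marginals (hT : 0 < T) {M : Fin T → Matrix (Fin n) (Fin n) ℝ}
    (hM : IsFeasible π A ρ M) :
    ∃ m : Fin (T + 1) → Fin n → ℝ, (∀ t : Fin T, M t *ᵥ 1 = m t.castSucc) ∧
      (∀ t : Fin T, (M t)ᵀ *ᵥ 1 = m t.succ) ∧ ∀ t, obsMatrix π *ᵥ m t = ρ t := by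
  obtain ⟨T, rfl⟩ := Nat.exists_eq_succ_of_ne_zero hT.ne'
  let m : Fin (T + 1 + 1) → Fin n → ℝ := Fin.cases (M 0 *ᵥ 1) fun t => (M t)ᵀ *ᵥ 1
  have h1 : ∀ t, M t *ᵥ 1 = m t.castSucc := by
    intro t
    cases t using Fin.cases with
    | zero => rfl
    | succ s => exact hM.matching s.castSucc s.succ (by simp)
  have h2 : ∀ t, (M t)ᵀ *ᵥ 1 = m t.succ := fun t => rfl
  refine ⟨m, h1, h2, fun t => ?_⟩
  cases t using Fin.lastCases with
  | last => rw [← Fin.succ_last, ← h2]; exact hM.obs_last _ rfl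
  | cast t => rw [← h1]; exact hM.obs t

/-- A regular problem comes with the marginals `m` and the transition matrices `B` of a Markov
chain that allows the same transitions as `A`. -/
theorem IsRegular.exists_markov_chain (hT : 0 < T)
    (hA : ∀ t, A t ∈ Matrix.rowStochastic ℝ (Fin n)) (hreg : IsRegular π A ρ)
    (hρ : ∀ i, 0 < ρ (Fin.last T) i) :
    ∃ (m : Fin (T + 1) → Fin n → ℝ) (B : Fin T → Matrix (Fin n) (Fin n) ℝ),
      (∀ t, obsMatrix π *ᵥ m t = ρ t) ∧ (∀ (t : Fin T) i, 0 < m t.castSucc i) ∧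
      (∀ t i, 0 < ρ t i) ∧ (∀ t, B t *ᵥ 1 = 1) ∧
      (∀ t : Fin T, (B t)ᵀ *ᵥ m t.castSucc = m t.succ) ∧
      (∀ t i j, 0 < A t i j → 0 < B t i j) ∧ ∀ t i j, A t i j = 0 → B t i j = 0 := by
  obtain ⟨M, hM, hpos⟩ := hreg
  obtain ⟨m, h1, h2, h3⟩ := hM.exists_marginals hT
  have hmpos : ∀ (t : Fin T) i, 0 < m t.castSucc i := by
    intro t i
    rw [← h1]
    obtain ⟨j, hj⟩ := exists_pos_of_mem_rowStochastic (hA t) i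
    exact mulVec_apply_pos (hM.nonneg t i) (fun _ => one_pos) (hpos t i j hj)
  -- The transition matrices are the rows of `M t` divided by their sums, which are positive because
  -- every row of `A t` has a positive entry.
  refine ⟨m, fun t => Matrix.of fun i j => M t i j / m t.castSucc i, h3, hmpos, ?_, ?_, ?_, ?_, ?_⟩
  · intro t i
    cases t using Fin.lastCases with
    -- The final marginal is a column sum and not a row sum, so its positivity is an assumption.
    | last => exact hρ i
    | cast t => rw [← h3, obsMatrix_mulVec]; exact hmpos t i
  · intro t
    funext i
    have h := congr_fun (h1 t) i
    simp only [mulVec, dotProduct, Pi.one_apply, mul_one, Matrix.of_apply] at h ⊢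
    rw [← Finset.sum_div, h, div_self (hmpos t i).ne']
  · intro t
    rw [← h2]
    funext j
    simp only [mulVec, dotProduct, Pi.one_apply, mul_one, Matrix.of_apply, transpose_apply]
    exact Finset.sum_congr rfl fun i _ => div_mul_cancel₀ _ (hmpos t i).ne'
  · exact fun t i j h => div_pos (hpos t i j h) (hmpos t i)
  · intro t i j h
    have := hM.supp t i j (by rw [diagonal_mul, h, mul_zero])
    change M t i j / _ = 0
    rw [this, zero_div]

end Regularity

/-! ### Block maximizers, sweeps, and the dual objective as an exponential sum. -/

section Sinkhorn

variable {n T : ℕ} {π : Finset (Fin n)} {A : Fin T → Matrix (Fin n) (Fin n) ℝ}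
  {ρ : Fin (T + 1) → {i // i ∈ π} → ℝ} {μ : Fin n → ℝ}

/-- Reading the pairing at time `t` gives coefficients independent of block `t`; unobserved states
have scaling `1` and go into the constant. -/
theorem dualObjective_update (lam : Fin (T + 1) → {i // i ∈ π} → ℝ) (t : Fin (T + 1)) :
    ∃ K, ∀ l, dualObjective π A ρ μ (Function.update lam t l) =
      K + ∑ i : {i // i ∈ π}, (ρ t i * l i -
        phi A (scaling π lam) t i * phiHat A μ (scaling π lam) t i * Real.exp (l i)) := by
  refine ⟨∑ s ∈ Finset.univ.erase t, lam s ⬝ᵥ ρ s - ∑ i : {i // i ∉ π},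
    phi A (scaling π lam) t i * phiHat A μ (scaling π lam) t i, fun l => ?_⟩
  have h1 : ∀ r, r ≠ t → scaling π (Function.update lam t l) r = scaling π lam r := fun r hr => by
    rw [scaling, scaling, Function.update_of_ne hr]
  have h2 : ∑ s, Function.update lam t l s ⬝ᵥ ρ s =
      l ⬝ᵥ ρ t + ∑ s ∈ Finset.univ.erase t, lam s ⬝ᵥ ρ s := by
    rw [← Finset.add_sum_erase _ _ (Finset.mem_univ t), Function.update_self]
    congr 1
    exact Finset.sum_congr rfl fun s hs => by rw [Function.update_of_ne (Finset.ne_of_mem_erase hs)]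
  rw [dualObjective, h2, dotProduct_chain t, phi_congr fun r hr => h1 r hr.ne',
    phiHat_congr fun r hr => h1 r hr.ne, scaling, Function.update_self]
  set φ := phi A (scaling π lam) t
  set φh := phiHat A μ (scaling π lam) t
  have h3 : blockScaling π l ⬝ᵥ (φ * φh) =
      ∑ i : {i // i ∈ π}, φ i * φh i * Real.exp (l i) + ∑ i : {i // i ∉ π}, φ i * φh i := by
    rw [dotProduct, ← Fintype.sum_subtype_add_sum_subtype (fun i => i ∈ π)]
    congr 1
    · exact Finset.sum_congr (by ext; simp) fun i _ => by
        rw [blockScaling_mem _ i.2, Pi.mul_apply, mul_comm]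
    · exact Finset.sum_congr rfl fun i _ => by
        rw [blockScaling_notMem _ i.2, Pi.mul_apply, one_mul]
  rw [h3, Finset.sum_sub_distrib, dotProduct_comm, dotProduct]
  ring

/-- The gap equals `p exp(s₀) (exp(s - s₀) - (s - s₀ + 1))`, which vanishes only at `s = s₀`. -/
theorem mul_sub_mul_exp_le {r p s s₀ : ℝ} (hp : 0 < p) (hs : Real.exp s₀ = r / p) :
    r * s - p * Real.exp s ≤ r * s₀ - p * Real.exp s₀ ∧
      (r * s - p * Real.exp s = r * s₀ - p * Real.exp s₀ → s = s₀) := by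
  have hr : r = p * Real.exp s₀ := by rw [hs]; field_simp
  have h1 : Real.exp s = Real.exp s₀ * Real.exp (s - s₀) := by
    rw [← Real.exp_add]; congr 1; ring
  have hp' := mul_pos hp (Real.exp_pos s₀)
  have h2 : (r * s₀ - p * Real.exp s₀) - (r * s - p * Real.exp s) =
      p * Real.exp s₀ * (Real.exp (s - s₀) - (s - s₀ + 1)) := by
    rw [hr, h1]; ring
  refine ⟨?_, fun h => ?_⟩
  · have := mul_nonneg hp'.le (sub_nonneg.2 (Real.add_one_le_exp (s - s₀)))
    linarith
  · by_contra hne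
    have := mul_pos hp' (sub_pos.2 (Real.add_one_lt_exp (sub_ne_zero.2 hne)))
    linarith

theorem isBlockMaximizer_iff {lam : Fin (T + 1) → {i // i ∈ π} → ℝ} {t : Fin (T + 1)}
    (hρ : ∀ i, 0 < ρ t i)
    (hpos : ∀ i : {i // i ∈ π},
      0 < phi A (scaling π lam) t i * phiHat A μ (scaling π lam) t i) (l : {i // i ∈ π} → ℝ) :
    IsBlockMaximizer (dualObjective π A ρ μ) lam t l ↔
      ∀ i, Real.exp (l i) =
        ρ t i / (phi A (scaling π lam) t i * phiHat A μ (scaling π lam) t i) := by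
  obtain ⟨K, hK⟩ := dualObjective_update (A := A) (ρ := ρ) (μ := μ) lam t
  set p := fun i : {i // i ∈ π} => phi A (scaling π lam) t i * phiHat A μ (scaling π lam) t i
  simp only [IsBlockMaximizer, hK, add_le_add_iff_left]
  constructor
  · intro h
    have hl : ∀ i, Real.exp (Real.log (ρ t i / p i)) = ρ t i / p i := fun i =>
      Real.exp_log (div_pos (hρ i) (hpos i))
    have h1 := h fun i => Real.log (ρ t i / p i)
    have h2 : ∀ i ∈ Finset.univ, ρ t i * l i - p i * Real.exp (l i) ≤
        ρ t i * Real.log (ρ t i / p i) - p i * Real.exp (Real.log (ρ t i / p i)) :=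
      fun i _ => (mul_sub_mul_exp_le (hpos i) (hl i)).1
    -- Termwise inequalities whose sums agree are termwise equalities.
    have h3 := (Finset.sum_eq_sum_iff_of_le h2).1 (le_antisymm (Finset.sum_le_sum h2) h1)
    intro i
    rw [(mul_sub_mul_exp_le (hpos i) (hl i)).2 (h3 i (Finset.mem_univ i)), hl]
  · exact fun h l' => Finset.sum_le_sum fun i _ => (mul_sub_mul_exp_le (hpos i) (h i)).1

theorem forwardPass_eq_phiHat (u : Fin (T + 1) → Fin n → ℝ) (t : Fin (T + 1)) :
    forwardPass π A ρ μ u t = phiHat A μ (sweep π A ρ μ u) t := by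
  induction t using Fin.induction with
  | zero => rfl
  | succ t ih =>
    rw [phiHat_succ, ← ih, sweep]
    simp [forwardPass]

theorem sweep_apply (u : Fin (T + 1) → Fin n → ℝ) (t : Fin (T + 1)) :
    sweep π A ρ μ u t = blockUpdate π (ρ t) (phi A u t) (phiHat A μ (sweep π A ρ μ u) t) := by
  rw [← forwardPass_eq_phiHat]; rfl

/-- A sweep of block coordinate ascent is a sweep of the Sinkhorn-type algorithm. -/
theorem isBlockMaximizer_midSweep_iff (hρ : ∀ t i, 0 < ρ t i)
    (hpos : ∀ (lam : Fin (T + 1) → {i // i ∈ π} → ℝ) t (i : {i // i ∈ π}),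
      0 < phi A (scaling π lam) t i * phiHat A μ (scaling π lam) t i)
    (old new : Fin (T + 1) → {i // i ∈ π} → ℝ) :
    (∀ t, IsBlockMaximizer (dualObjective π A ρ μ) (midSweep old new t) t (new t)) ↔
      sweep π A ρ μ (scaling π old) = scaling π new := by
  have h1 : ∀ t, IsBlockMaximizer (dualObjective π A ρ μ) (midSweep old new t) t (new t) ↔
      scaling π new t = blockUpdate π (ρ t) (phi A (scaling π old) t)
        (phiHat A μ (scaling π new) t) := by
    intro t
    rw [isBlockMaximizer_iff (hρ t) (hpos _ t), scaling.eq_1 π new,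
      blockScaling_eq_blockUpdate_iff,
      phi_congr (u := scaling π (midSweep old new t)) (u' := scaling π old) fun r hr => by
        simp [scaling, midSweep, hr.not_gt],
      phiHat_congr (u := scaling π (midSweep old new t)) (u' := scaling π new) fun r hr => by
        simp [scaling, midSweep, hr]]
  simp only [h1]
  constructor
  · intro h
    -- Strong induction in time: the update of block `t` involves the new point only through blocks
    -- before `t`.
    funext t
    induction t using WellFoundedLT.induction with
    | ind t ih => rw [sweep_apply, h, phiHat_congr ih]
  · intro h t
    rw [← h, ← sweep_apply]

/-- Whatever the positive start, one sweep sets the unobserved entries to `1` and leaves positive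
observed entries, whose logarithms are the multipliers. -/
theorem exists_sweep_eq_scaling (hρ : ∀ t i, 0 < ρ t i) (hA : ∀ t i j, 0 ≤ A t i j)
    (hrow : ∀ t i, ∃ j, 0 < A t i j) {m : Fin (T + 1) → Fin n → ℝ}
    (hm : ∀ (t : Fin T) i, 0 < m t.castSucc i)
    (hcol : ∀ (t : Fin T) j, 0 < m t.succ j → ∃ i, 0 < A t i j)
    (hmobs : ∀ t (i : {i // i ∈ π}), 0 < m t i) (hμ : ∀ i, 0 < μ i)
    {u : Fin (T + 1) → Fin n → ℝ} (hu : ∀ t i, 0 < u t i) :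
    ∃ lam, sweep π A ρ μ u = scaling π lam := by
  have hex : ∀ t, ∃ l, sweep π A ρ μ u t = blockScaling π l := by
    intro t
    induction t using WellFoundedLT.induction with
    | ind t ih =>
      have hpos : ∀ r, r < t → ∀ i, 0 < sweep π A ρ μ u r i := fun r hr i => by
        obtain ⟨l, hl⟩ := ih r hr
        rw [hl]; exact blockScaling_pos l i
      refine ⟨fun i => Real.log (ρ t i / (phi A u t i * phiHat A μ (sweep π A ρ μ u) t i)), ?_⟩
      rw [sweep_apply, eq_comm, blockScaling_eq_blockUpdate_iff]
      exact fun i => Real.exp_log (div_pos (hρ t i) (mul_pos (phi_pos hA hrow hu t i)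
        (phiHat_pos hA hm hcol hμ hpos (hmobs t i))))
  choose lam hlam using hex
  exact ⟨lam, funext hlam⟩

/-- The sum `∑ t, (Cᵀ λ_t)(x_t)` along a path `x`. -/
noncomputable def pathExponent (π : Finset (Fin n)) (x : Fin (T + 1) → Fin n) :
    (Fin (T + 1) → {i // i ∈ π} → ℝ) →L[ℝ] ℝ :=
  LinearMap.toContinuousLinearMap
    (∑ t, LinearMap.proj (x t) ∘ₗ (obsMatrix π)ᵀ.mulVecLin ∘ₗ LinearMap.proj t)

theorem pathExponent_apply (x : Fin (T + 1) → Fin n) (lam : Fin (T + 1) → {i // i ∈ π} → ℝ) :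
    pathExponent π x lam = ∑ t, ((obsMatrix π)ᵀ *ᵥ lam t) (x t) := by
  simp [pathExponent, mulVec_transpose]

theorem pathExponent_single (x : Fin (T + 1) → Fin n) (t : Fin (T + 1)) {i : {i // i ∈ π}}
    (hx : x t = i) (l : {i // i ∈ π} → ℝ) : pathExponent π x (Pi.single t l) = l i := by
  rw [pathExponent_apply, Finset.sum_eq_single t]
  · rw [Pi.single_eq_same, hx, obsMatrix_transpose_mulVec_mem _ i.2]
  · intro s _ hs
    rw [Pi.single_eq_of_ne hs, mulVec_zero, Pi.zero_apply]
  · simp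

/-- Since `ρ t` is the observed time-`t` marginal of the path law of `B`, the linear term is an
expectation of the path exponent. -/
theorem dualObjective_eq_sum_paths {m : Fin (T + 1) → Fin n → ℝ}
    {B : Fin T → Matrix (Fin n) (Fin n) ℝ} (hm : ∀ t, obsMatrix π *ᵥ m t = ρ t)
    (hB : ∀ t, B t *ᵥ 1 = 1) (hBm : ∀ t : Fin T, (B t)ᵀ *ᵥ m t.castSucc = m t.succ)
    (lam : Fin (T + 1) → {i // i ∈ π} → ℝ) :
    dualObjective π A ρ μ lam = -∑ x, (pathWeight A μ x * Real.exp (pathExponent π x lam) -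
      pathWeight B (m 0) x * pathExponent π x lam) := by
  have h1 : ∑ t, lam t ⬝ᵥ ρ t = ∑ x, pathWeight B (m 0) x * pathExponent π x lam := by
    simp only [pathExponent_apply, Finset.mul_sum]
    rw [Finset.sum_comm]
    refine Finset.sum_congr rfl fun t _ => ?_
    rw [sum_pathWeight_mul hB hBm t, ← hm, dotProduct_mulVec, ← mulVec_transpose,
      dotProduct_comm]
  rw [dualObjective, h1, dotProduct_chain_eq_sum_paths, Finset.sum_sub_distrib, neg_sub]
  congr 1
  refine Finset.sum_congr rfl fun x _ => ?_
  rw [pathExponent_apply, Real.exp_sum]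
  rfl

theorem pathWeight_pos_or_eq_zero {m₀ : Fin n → ℝ} {B : Fin T → Matrix (Fin n) (Fin n) ℝ}
    (hμ : ∀ i, 0 < μ i) (hm₀ : ∀ i, 0 < m₀ i) (hA : ∀ t i j, 0 ≤ A t i j)
    (hpos : ∀ t i j, 0 < A t i j → 0 < B t i j) (hzero : ∀ t i j, A t i j = 0 → B t i j = 0)
    (x : Fin (T + 1) → Fin n) :
    (0 < pathWeight A μ x ∧ 0 < pathWeight B m₀ x) ∨
      (pathWeight A μ x = 0 ∧ pathWeight B m₀ x = 0) := by
  by_cases h : ∀ t : Fin T, 0 < A t (x t.castSucc) (x t.succ)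
  · exact .inl ⟨mul_pos (hμ _) (Finset.prod_pos fun t _ => h t),
      mul_pos (hm₀ _) (Finset.prod_pos fun t _ => hpos _ _ _ (h t))⟩
  · push Not at h
    obtain ⟨t, ht⟩ := h
    have h0 := le_antisymm ht (hA _ _ _)
    exact .inr ⟨mul_eq_zero_of_right _ (Finset.prod_eq_zero (Finset.mem_univ t) h0),
      mul_eq_zero_of_right _ (Finset.prod_eq_zero (Finset.mem_univ t) (hzero _ _ _ h0))⟩

theorem exists_tendsto_maximizer {m : Fin (T + 1) → Fin n → ℝ}
    {B : Fin T → Matrix (Fin n) (Fin n) ℝ} (hm : ∀ t, obsMatrix π *ᵥ m t = ρ t)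
    (hρ : ∀ t i, 0 < ρ t i) (hm₀ : ∀ i, 0 < m 0 i) (hB : ∀ t, B t *ᵥ 1 = 1)
    (hBm : ∀ t : Fin T, (B t)ᵀ *ᵥ m t.castSucc = m t.succ)
    (hμ : ∀ i, 0 < μ i) (hA : ∀ t i j, 0 ≤ A t i j)
    (hpos : ∀ t i j, 0 < A t i j → 0 < B t i j) (hzero : ∀ t i j, A t i j = 0 → B t i j = 0)
    {lam : ℕ → Fin (T + 1) → {i // i ∈ π} → ℝ}
    (hlam : IsBlockCoordinateAscent (dualObjective π A ρ μ) lam) :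
    ∃ lamStar, (∀ x, dualObjective π A ρ μ x ≤ dualObjective π A ρ μ lamStar) ∧
      Tendsto lam atTop (𝓝 lamStar) := by
  classical
  have hdich := pathWeight_pos_or_eq_zero (A := A) (T := T) hμ hm₀ hA hpos hzero
  -- Only paths of positive prior weight are kept, so that both coefficient families are strictly
  -- positive; the other paths contribute zero.
  refine hlam.exists_tendsto (ι := {x // 0 < pathWeight A μ x})
    (w := fun x => pathWeight A μ x.1) (p := fun x => pathWeight B (m 0) x.1)
    (a := fun x => pathExponent π x.1) (fun x => x.2) (fun x => ?_) (fun t i => ?_) fun lam => ?_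
  · rcases hdich x.1 with h | h
    · exact h.2
    · exact absurd h.1 x.2.ne'
  -- The paths through `i` at time `t` have total `B`-mass `ρ t i > 0`, so one of them has positive
  -- weight and its exponent restricts to coordinate `i`.
  · have h1 := sum_pathWeight_mul hB hBm t (Pi.single i.1 1)
    rw [dotProduct_single_one, ← obsMatrix_mulVec (m t) i, hm] at h1
    obtain ⟨x, -, hx⟩ := Finset.exists_ne_zero_of_sum_ne_zero (h1.trans_ne (hρ t i).ne')
    have hxt : x t = i := by
      by_contra hne
      exact hx (by rw [Pi.single_eq_of_ne hne, mul_zero])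
    have hxw : 0 < pathWeight A μ x := by
      rcases hdich x with h | h
      · exact h.1
      · exact absurd (by rw [h.2, zero_mul]) hx
    exact ⟨⟨x, hxw⟩, pathExponent_single x t hxt⟩
  · rw [dualObjective_eq_sum_paths hm hB hBm, expSum,
      ← Fintype.sum_subtype_add_sum_subtype (fun x => 0 < pathWeight A μ x), neg_inj,
      add_eq_left]
    refine Finset.sum_eq_zero fun x _ => ?_
    rcases hdich x.1 with h | h
    · exact absurd h.1 x.2
    · rw [h.1, h.2, zero_mul, zero_mul, sub_zero]

end Sinkhorn

end PartialBridge

theorem mainTheorem8 (n T : ℕ) (hT : 0 < T) (π : Finset (Fin n))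
    (A : Fin T → Matrix (Fin n) (Fin n) ℝ)
    (hA : ∀ t, A t ∈ Matrix.rowStochastic ℝ (Fin n))
    (ρ : Fin (T + 1) → {i // i ∈ π} → ℝ)
    (hreg : PartialBridge.IsRegular π A ρ)
    (hρ : ∀ i, 0 < ρ (Fin.last T) i)
    (η : {i // i ∉ π} → ℝ) (hη : ∀ j, 0 < η j)
    (μ : Fin n → ℝ) (hμ : μ = PartialBridge.initialPrior π ρ η) :
    -- the block maximizers of the dual objective, in terms of the two recursions
    (∀ (lam : Fin (T + 1) → {i // i ∈ π} → ℝ) (t : Fin (T + 1)),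
      (∀ i, 0 < (PartialBridge.obsMatrix π *ᵥ
        (PartialBridge.phi A (PartialBridge.scaling π lam) t *
          PartialBridge.phiHat A μ (PartialBridge.scaling π lam) t)) i) ∧
      (∃! l, PartialBridge.IsBlockMaximizer (PartialBridge.dualObjective π A ρ μ) lam t l) ∧
      ∀ l, PartialBridge.IsBlockMaximizer (PartialBridge.dualObjective π A ρ μ) lam t l ↔
        (PartialBridge.obsMatrix π *ᵥ PartialBridge.blockScaling π l =
            ρ t / (PartialBridge.obsMatrix π *ᵥ
              (PartialBridge.phi A (PartialBridge.scaling π lam) t *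
                PartialBridge.phiHat A μ (PartialBridge.scaling π lam) t)) ∧
          PartialBridge.unobsMatrix π *ᵥ PartialBridge.blockScaling π l = 1)) ∧
    -- block coordinate ascent is the Sinkhorn-type algorithm, and it converges to a maximizer
    (∀ lam : ℕ → Fin (T + 1) → {i // i ∈ π} → ℝ,
      PartialBridge.IsBlockCoordinateAscent (PartialBridge.dualObjective π A ρ μ) lam →
      (∀ s, (PartialBridge.sweep π A ρ μ)^[s] (PartialBridge.scaling π (lam 0)) =
        PartialBridge.scaling π (lam s)) ∧
      ∃ lamStar, (∀ lam', PartialBridge.dualObjective π A ρ μ lam' ≤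
          PartialBridge.dualObjective π A ρ μ lamStar) ∧
        Tendsto lam atTop (𝓝 lamStar)) ∧
    -- the algorithm started at an arbitrary positive point
    (∀ u₀ : Fin (T + 1) → Fin n → ℝ, (∀ t i, 0 < u₀ t i) →
      (∃ lam : ℕ → Fin (T + 1) → {i // i ∈ π} → ℝ,
        PartialBridge.IsBlockCoordinateAscent (PartialBridge.dualObjective π A ρ μ) lam ∧
        ∀ s, (PartialBridge.sweep π A ρ μ)^[s + 1] u₀ = PartialBridge.scaling π (lam s)) ∧
      ∃ lamStar, (∀ lam', PartialBridge.dualObjective π A ρ μ lam' ≤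
          PartialBridge.dualObjective π A ρ μ lamStar) ∧
        Tendsto (fun s => (PartialBridge.sweep π A ρ μ)^[s] u₀) atTop
          (𝓝 (PartialBridge.scaling π lamStar))) := by
  obtain ⟨m, B, hm, hmpos, hρpos, hB, hBm, hpos, hzero⟩ :=
    PartialBridge.IsRegular.exists_markov_chain hT hA hreg hρ
  have hA0 : ∀ t i j, 0 ≤ A t i j := fun t => (hA t).1
  have hrow : ∀ t i, ∃ j, 0 < A t i j := fun t =>
    PartialBridge.exists_pos_of_mem_rowStochastic (hA t)
  have hcol : ∀ (t : Fin T) j, 0 < m t.succ j → ∃ i, 0 < A t i j := by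
    intro t j hj
    rw [← hBm, mulVec, dotProduct] at hj
    obtain ⟨i, -, hi⟩ := Finset.exists_ne_zero_of_sum_ne_zero hj.ne'
    exact ⟨i, (hA0 t i j).lt_of_ne' fun h => hi (by
      rw [transpose_apply, hzero t i j h, zero_mul])⟩
  have hmobs : ∀ t (i : {i // i ∈ π}), 0 < m t i := fun t i => by
    rw [← PartialBridge.obsMatrix_mulVec (m t) i, hm]
    exact hρpos t i
  -- Since `T ≥ 1`, time `0` is not the final time, so `m 0` is positive at unobserved states too.
  have hm0 : ∀ i, 0 < m 0 i := hmpos ⟨0, hT⟩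
  have hμpos : ∀ i, 0 < μ i := hμ ▸ PartialBridge.initialPrior_pos (hρpos 0) hη
  have hφ : ∀ (lam : Fin (T + 1) → {i // i ∈ π} → ℝ) t (i : {i // i ∈ π}),
      0 < PartialBridge.phi A (PartialBridge.scaling π lam) t i *
        PartialBridge.phiHat A μ (PartialBridge.scaling π lam) t i := fun lam t i =>
    mul_pos (PartialBridge.phi_pos hA0 hrow (fun _ _ => PartialBridge.blockScaling_pos _ _) t i)
      (PartialBridge.phiHat_pos hA0 hmpos hcol hμpos
        (fun _ _ _ => PartialBridge.blockScaling_pos _ _) (hmobs t i))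
  have hconv : ∀ lam : ℕ → Fin (T + 1) → {i // i ∈ π} → ℝ,
      PartialBridge.IsBlockCoordinateAscent (PartialBridge.dualObjective π A ρ μ) lam →
      ∃ lamStar, (∀ lam', PartialBridge.dualObjective π A ρ μ lam' ≤
        PartialBridge.dualObjective π A ρ μ lamStar) ∧ Tendsto lam atTop (𝓝 lamStar) :=
    fun lam hlam => PartialBridge.exists_tendsto_maximizer hm hρpos hm0 hB hBm hμpos hA0 hpos
      hzero hlam
  refine ⟨fun lam t => ⟨fun i => ?_, ?_, fun l => ?_⟩, fun lam hlam => ⟨fun s => ?_, hconv lam hlam⟩,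
    fun u₀ hu₀ => ?_⟩
  · rw [PartialBridge.obsMatrix_mulVec]
    exact hφ lam t i
  · simp only [PartialBridge.isBlockMaximizer_iff (hρpos t) (hφ lam t)]
    exact ⟨fun i => Real.log (ρ t i / _), fun i => Real.exp_log (div_pos (hρpos t i) (hφ lam t i)),
      fun l hl => funext fun i => by rw [← hl i, Real.log_exp]⟩
  · rw [PartialBridge.isBlockMaximizer_iff (hρpos t) (hφ lam t)]
    have h1 : PartialBridge.unobsMatrix π *ᵥ PartialBridge.blockScaling π l = 1 := by
      funext j
      rw [PartialBridge.unobsMatrix_mulVec, PartialBridge.blockScaling_notMem _ j.2, Pi.one_apply]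
    rw [and_iff_left h1, funext_iff]
    refine forall_congr' fun i => ?_
    rw [PartialBridge.obsMatrix_mulVec, PartialBridge.blockScaling_mem _ i.2, Pi.div_apply,
      PartialBridge.obsMatrix_mulVec, Pi.mul_apply]
  · induction s with
    | zero => rfl
    | succ s ih =>
      rw [Function.iterate_succ_apply', ih]
      exact (PartialBridge.isBlockMaximizer_midSweep_iff hρpos hφ _ _).1 (hlam s)
  · have hex : ∀ s, ∃ lam, (PartialBridge.sweep π A ρ μ)^[s + 1] u₀ =
        PartialBridge.scaling π lam := by
      intro s
      rw [Function.iterate_succ_apply']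
      refine PartialBridge.exists_sweep_eq_scaling hρpos hA0 hrow hmpos hcol hmobs hμpos ?_
      induction s with
      | zero => exact hu₀
      | succ s ih =>
        rw [Function.iterate_succ_apply']
        obtain ⟨lam, hlam⟩ := PartialBridge.exists_sweep_eq_scaling hρpos hA0 hrow hmpos hcol
          hmobs hμpos ih
        rw [hlam]
        exact fun _ _ => PartialBridge.blockScaling_pos _ _
    choose lam hlam using hex
    have hbca : PartialBridge.IsBlockCoordinateAscent
        (PartialBridge.dualObjective π A ρ μ) lam := by
      intro s
      refine (PartialBridge.isBlockMaximizer_midSweep_iff hρpos hφ _ _).2 ?_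
      rw [← hlam, ← hlam, Function.iterate_succ_apply' _ (s + 1)]
    refine ⟨⟨lam, hbca, hlam⟩, ?_⟩
    obtain ⟨lamStar, hmax, htend⟩ := hconv lam hbca
    -- The index is shifted by one because `u₀` itself need not have the form `exp (Cᵀ λ)`.
    refine ⟨lamStar, hmax, (tendsto_add_atTop_iff_nat 1).1 ?_⟩
    simp only [hlam]
    exact (PartialBridge.continuous_scaling.tendsto lamStar).comp htend
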